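/- Throughout, a surface is a connected, Hausdorff, second countable topological $2$-manifold without boundary. It is of infinite type if its fundamental group is not finitely generated. For an orientable surface $S$, the mapping class group $\mathrm{Mod}(S)$ is the group of homotopy classes of orientation-preserving self-homeomorphisms of $S$. The flute surface is $\Sigma = \mathbb{R}^2\setminus\{(0,0),(1,0),(2,0),\dots\}$. A covering map is regular if its group of deck transformations acts transitively on each fibre. Theorem. For every countable group $G$ there is an orientable surface $S$ without boundary, of infinite type, such that $G$ is isomorphic to a subgroup of $\mathrm{Mod}(S)$. Moreover, $S$ can be chosen so that there are a regular covering map $p\colon S\to\Sigma$ and an isomorphism $g\mapsto\rho_g$ from $G$ onto the group of deck transformations of $p$ such that every $\rho_g$ preserves orientation and the map $G\to\mathrm{Mod}(S)$, $g\mapsto[\rho_g]$, is an injective homomorphism. -/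

import Mathlib

open scoped Manifold

/-- A map `f` of the plane `ℂ = ℝ²` preserves orientation at `z₀`: it is continuous at `z₀` and, on
some punctured disc around `z₀`, `(f z - f z₀) / (z - z₀)` has a continuous logarithm `L`.
The existence of `L` says that `f z - f z₀` never vanishes on the punctured disc and has, along each
small circle around `z₀`, the same winding number about `0` as `z - z₀`, namely `1`. So for a local
homeomorphism `f` this says that the local degree of `f` at `z₀` is `+1` (and not `-1`). -/
def PreservesOrientationAt (f : ℂ → ℂ) (z₀ : ℂ) : Prop :=
  ContinuousAt f z₀ ∧ ∃ r : ℝ, 0 < r ∧ ∃ L : ℂ → ℂ,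
    ContinuousOn L (Metric.ball z₀ r \ {z₀}) ∧
    ∀ z ∈ Metric.ball z₀ r \ {z₀}, f z - f z₀ = (z - z₀) * Complex.exp (L z)

theorem PreservesOrientationAt.id (z₀ : ℂ) : PreservesOrientationAt (fun z => z) z₀ :=
  ⟨continuousAt_id, 1, one_pos, fun _ => 0, continuousOn_const, fun z _ => by simp⟩

theorem PreservesOrientationAt.comp {f g : ℂ → ℂ} {z₀ : ℂ}
    (hg : PreservesOrientationAt g (f z₀)) (hf : PreservesOrientationAt f z₀) :
    PreservesOrientationAt (g ∘ f) z₀ := by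
  obtain ⟨hgc, s, hs, M, hM, hgM⟩ := hg
  obtain ⟨hfc, r, hr, L, hL, hfL⟩ := hf
  refine ⟨hgc.comp hfc, ?_⟩
  obtain ⟨δ, hδ, hδs⟩ := Metric.continuousAt_iff.1 hfc s hs
  have hsub : Metric.ball z₀ (min r δ) \ {z₀} ⊆ Metric.ball z₀ r \ {z₀} :=
    Set.sdiff_subset_sdiff_left (Metric.ball_subset_ball (min_le_left _ _))
  have hmaps : ∀ z ∈ Metric.ball z₀ (min r δ) \ {z₀}, f z ∈ Metric.ball (f z₀) s \ {f z₀} := by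
    intro z hz
    refine ⟨hδs (lt_of_lt_of_le hz.1 (min_le_right _ _)), fun h => ?_⟩
    have h1 := hfL z (hsub hz)
    rw [Set.mem_singleton_iff.1 h, sub_self] at h1
    rcases mul_eq_zero.1 h1.symm with h2 | h2
    · exact hz.2 (sub_eq_zero.1 h2)
    · exact Complex.exp_ne_zero _ h2
  have hfcont : ContinuousOn f (Metric.ball z₀ (min r δ) \ {z₀}) := by
    have h1 : ContinuousOn (fun z => f z₀ + (z - z₀) * Complex.exp (L z))
        (Metric.ball z₀ (min r δ) \ {z₀}) :=
      continuousOn_const.add ((continuousOn_id.sub continuousOn_const).mul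
        (Complex.continuous_exp.comp_continuousOn (hL.mono hsub)))
    exact h1.congr fun z hz => (sub_eq_iff_eq_add'.1 (hfL z (hsub hz)))
  refine ⟨min r δ, lt_min hr hδ, fun z => L z + M (f z),
    (hL.mono hsub).add (hM.comp hfcont hmaps), fun z hz => ?_⟩
  rw [Function.comp_apply, Function.comp_apply, hgM _ (hmaps z hz), hfL z (hsub hz),
    Complex.exp_add, mul_assoc]

theorem PreservesOrientationAt.congr {f g : ℂ → ℂ} {z₀ : ℂ} (hf : PreservesOrientationAt f z₀)
    (h : g =ᶠ[nhds z₀] f) : PreservesOrientationAt g z₀ := by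
  obtain ⟨hfc, r, hr, L, hL, hfL⟩ := hf
  refine ⟨hfc.congr h.symm, ?_⟩
  obtain ⟨ε, hε, hball⟩ := Metric.eventually_nhds_iff_ball.1 h
  have hsub : Metric.ball z₀ (min r ε) \ {z₀} ⊆ Metric.ball z₀ r \ {z₀} :=
    Set.sdiff_subset_sdiff_left (Metric.ball_subset_ball (min_le_left _ _))
  refine ⟨min r ε, lt_min hr hε, L, hL.mono hsub, fun z hz => ?_⟩
  rw [hball z (Metric.ball_subset_ball (min_le_right _ _) hz.1), h.eq_of_nhds]
  exact hfL z (hsub hz)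

/-- Orientation-preserving partial maps of the plane. -/
noncomputable def orientationPregroupoid : Pregroupoid ℂ where
  property f s := ∀ z ∈ s, PreservesOrientationAt f z
  comp hf hg _ _ _ z hz := (hg _ hz.2).comp (hf z hz.1)
  id_mem z _ := PreservesOrientationAt.id z
  locality _ h z hz := by
    obtain ⟨v, _, hzv, hv⟩ := h z hz
    exact hv z ⟨hz, hzv⟩
  congr hu h hf z hz := (hf z hz).congr (Filter.eventually_of_mem (hu.mem_nhds hz) h)

/-- The groupoid of orientation-preserving homeomorphisms between open subsets of the plane. -/
noncomputable def orientationGroupoid : StructureGroupoid ℂ := orientationPregroupoid.groupoid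

/-- A connected oriented (topological) surface without boundary: a connected, Hausdorff, second
countable space with an atlas of charts onto open subsets of the plane, all of whose transition
maps preserve orientation. The orientation is the one given by the atlas; a connected surface is
orientable if and only if it admits such an atlas. -/
class OrientedSurface (S : Type*) [TopologicalSpace S] [ChartedSpace ℂ S] : Prop extends
  T2Space S, SecondCountableTopology S, ConnectedSpace S, HasGroupoid S orientationGroupoid

/-- A surface is of infinite type if its fundamental group is not finitely generated. -/
def IsInfiniteType (S : Type*) [TopologicalSpace S] : Prop :=
  ∀ x : S, ¬ Group.FG (FundamentalGroup S x)

section MappingClassGroup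

variable (S : Type*) [TopologicalSpace S] [ChartedSpace ℂ S] [OrientedSurface S]

/-- `Homeo⁺(S)`: the group of orientation-preserving self-homeomorphisms of `S`, i.e. those that
preserve orientation when read in any two charts of the oriented atlas. -/
def homeoPlus : Subgroup (S ≃ₜ S) where
  carrier := {h | ∀ c ∈ atlas ℂ S, ∀ c' ∈ atlas ℂ S,
    c.symm ≫ₕ h.toOpenPartialHomeomorph ≫ₕ c' ∈ orientationGroupoid}
  one_mem' c hc c' hc' :=
    (Structomorph.refl (G := orientationGroupoid) S).mem_groupoid c c' hc hc'
  mul_mem' {a b} ha hb c hc c' hc' :=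
    (Structomorph.trans (G := orientationGroupoid)
      ⟨b, fun c c' hc hc' => hb c hc c' hc'⟩
      ⟨a, fun c c' hc hc' => ha c hc c' hc'⟩).mem_groupoid c c' hc hc'
  inv_mem' {a} ha c hc c' hc' :=
    (Structomorph.symm (G := orientationGroupoid)
      ⟨a, fun c c' hc hc' => ha c hc c' hc'⟩).mem_groupoid c c' hc hc'

/-- Two orientation-preserving homeomorphisms of `S` are homotopic (as maps `S → S`). -/
def HomeoHomotopic (f g : homeoPlus S) : Prop :=
  ContinuousMap.Homotopic (f.1 : C(S, S)) (g.1 : C(S, S))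

/-- The normal subgroup of `Homeo⁺(S)` of the homeomorphisms homotopic to the identity. -/
def homeoPlusZero : Subgroup (homeoPlus S) where
  carrier := {h | HomeoHomotopic S h 1}
  one_mem' := ContinuousMap.Homotopic.refl _
  mul_mem' {_ _} ha hb := ContinuousMap.Homotopic.comp ha hb
  inv_mem' {a} ha := by
    have h := ContinuousMap.Homotopic.comp
      (ContinuousMap.Homotopic.refl ((a⁻¹).1 : C(S, S))) ha
    have h1 : (((a⁻¹).1 : S ≃ₜ S) : C(S, S)).comp ((a.1 : S ≃ₜ S) : C(S, S))
        = (((1 : homeoPlus S).1 : S ≃ₜ S) : C(S, S)) := by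
      ext x; exact a.1.symm_apply_apply x
    rw [h1] at h
    exact h.symm

instance homeoPlusZero_normal : (homeoPlusZero S).Normal where
  conj_mem n hn g := by
    have h := ContinuousMap.Homotopic.comp
      (ContinuousMap.Homotopic.comp (ContinuousMap.Homotopic.refl (g.1 : C(S, S))) hn)
      (ContinuousMap.Homotopic.refl ((g⁻¹).1 : C(S, S)))
    have h1 : (((g.1 : S ≃ₜ S) : C(S, S)).comp (((1 : homeoPlus S).1 : S ≃ₜ S) : C(S, S))).comp
        (((g⁻¹).1 : S ≃ₜ S) : C(S, S)) = (((1 : homeoPlus S).1 : S ≃ₜ S) : C(S, S)) := by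
      ext x; exact g.1.apply_symm_apply x
    rw [h1] at h
    exact h

/-- The mapping class group `Mod(S)`: the group of homotopy classes of orientation-preserving
self-homeomorphisms of `S`. -/
abbrev MappingClassGroup : Type _ := homeoPlus S ⧸ homeoPlusZero S

/-- The homomorphism `Homeo⁺(S) → Mod(S)` sending a homeomorphism to its homotopy class. -/
abbrev mappingClass : homeoPlus S →* MappingClassGroup S := QuotientGroup.mk' (homeoPlusZero S)

/-- Two homeomorphisms have the same mapping class precisely when they are homotopic. -/
theorem mappingClass_eq_iff (f g : homeoPlus S) :
    mappingClass S f = mappingClass S g ↔ HomeoHomotopic S f g := by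
  have key : mappingClass S f = mappingClass S g ↔ HomeoHomotopic S (f⁻¹ * g) 1 :=
    QuotientGroup.eq
  rw [key]
  constructor
  · intro h
    have h2 := ContinuousMap.Homotopic.comp (ContinuousMap.Homotopic.refl (f.1 : C(S, S))) h
    have h3 : ((f.1 : S ≃ₜ S) : C(S, S)).comp (((f⁻¹ * g).1 : S ≃ₜ S) : C(S, S)) =
        ((g.1 : S ≃ₜ S) : C(S, S)) := by
      ext x; exact f.1.apply_symm_apply (g.1 x)
    rw [h3] at h2
    exact h2.symm
  · intro h
    have h2 := ContinuousMap.Homotopic.comp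
      (ContinuousMap.Homotopic.refl ((f⁻¹).1 : C(S, S))) h
    have h3 : (((f⁻¹).1 : S ≃ₜ S) : C(S, S)).comp ((f.1 : S ≃ₜ S) : C(S, S)) =
        (((1 : homeoPlus S).1 : S ≃ₜ S) : C(S, S)) := by
      ext x; exact f.1.symm_apply_apply x
    rw [h3] at h2
    exact h2.symm

end MappingClassGroup

/-- The flute surface `ℝ² \ {(0,0), (1,0), (2,0), …}`, with `ℝ² = ℂ`. -/
abbrev FluteSurface : Type := {z : ℂ // ∀ n : ℕ, z ≠ (n : ℂ)}

/-- The group of deck transformations of `p : S → B`. -/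
def deckGroup {S B : Type*} [TopologicalSpace S] (p : S → B) : Subgroup (S ≃ₜ S) where
  carrier := {h | ∀ x, p (h x) = p x}
  one_mem' _ := rfl
  mul_mem' {a b} ha hb x := (ha (b x)).trans (hb x)
  inv_mem' {a} ha x := by
    have h := ha (a.symm x)
    rw [a.apply_symm_apply] at h
    exact h.symm

/-- A regular (normal, Galois) covering map: a surjective covering map whose deck transformations
act transitively on each fibre. -/
def IsRegularCovering {S B : Type*} [TopologicalSpace S] [TopologicalSpace B] (p : S → B) : Prop :=
  IsCoveringMap p ∧ Function.Surjective p ∧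
    ∀ x y : S, p x = p y → ∃ h ∈ deckGroup p, h x = y

/-!
Let `a : ℕ → G` be a surjective sequence with `a 0 = a 1 = 1` and `a n = a (n + 1) = 1` for
infinitely many `n`. Cut the flute surface along the vertical rays going down from the punctures, or
along those going up. Both slit planes are connected, and they meet in the half plane left of the
punctures (the `0`-th strip) and in the vertical strips between consecutive punctures. Gluing copies
of them indexed by `G` along the `n`-th strip with the shift `a n` gives a principal `G`-bundle
`fluteCover a`, whose total space is the surface `S`. It is connected because `a` is surjective
(`connectedSpace_fluteCover`), and its deck group is `G`, acting on the sheets by right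
multiplication. The projection `S → ℂ` is a local homeomorphism; its restrictions are charts whose
transition maps are identities, and the deck transformations are also identities in these charts,
so `S` is an oriented surface and `G` acts by orientation-preserving homeomorphisms.

The other two claims come down to continuous logarithms. Write `p` for the projection. If
`a n = a (n + 1) = 1`, the loop around the `n`-th puncture lifts to a loop of `S`, and the function
`p - n` has no continuous logarithm along it (`not_closed_log_circle`).

* If `π₁(S)` were finitely generated, the generators would be carried by a compact set, so for large
  `n` their images under `p - n` would stay in a half plane, and by the lifting criterion `p - n`
  would have a global logarithm on `S` (`exists_log_sub_natCast`). This fails for infinitely many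
  `n`.
* Let `g ≠ 1`. The function `sheetOneCollapse : S → ℂ ∖ {0}` winds once around the puncture over `0`
  in the sheet `1`, and is constant on the loop around the puncture over `0` in any other sheet. The
  deck transformation of `g` maps the first loop to one of the others, while a map homotopic to the
  identity preserves winding numbers along loops (`eq_one_of_deckHomeomorph_homotopic`).
-/

/-! ### Continuous logarithms -/

section

open Complex Topology unitInterval

theorem sub_eq_sub_of_exp_eq {X : Type*} [TopologicalSpace X] [PreconnectedSpace X] {f g : X → ℂ}
    (hf : Continuous f) (hg : Continuous g) (h : ∀ x, exp (f x) = exp (g x)) (x y : X) :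
    f x - g x = f y - g y := by
  refine isCoveringMap_exp.const_of_comp (hf.sub hg) (fun a b => Subtype.ext ?_) x y
  simp [exp_sub, h]

theorem exists_continuous_log {f : I × I → ℂ} (hf : Continuous f) (h0 : ∀ x, f x ≠ 0) :
    ∃ L : I × I → ℂ, Continuous L ∧ ∀ x, exp (L x) = f x := by
  let P : ℝ → I := Set.projIcc 0 1 zero_le_one
  have hP : Continuous P := continuous_projIcc
  -- `ℝ × ℝ` retracts onto the square and is contractible
  obtain ⟨F, ⟨-, hF⟩, -⟩ := isCoveringMapOn_exp.existsUnique_continuousMap_lifts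
    (A := ℝ × ℝ) ⟨fun x => f (P x.1, P x.2), by fun_prop⟩ (a₀ := (0, 0))
    (e₀ := log (f (P 0, P 0))) (exp_log (h0 _)) (fun _ => h0 _)
  refine ⟨fun x => F (x.1, x.2), by fun_prop, fun x => (congrFun hF (x.1, x.2)).trans ?_⟩
  simp [P, Set.projIcc_val]

/-- The loop `θ ↦ r e^{2πiθ}` has no closed logarithm. -/
theorem not_closed_log_circle {r : ℂ} (hr : r ≠ 0) {L : I → ℂ} (hL : Continuous L)
    (h : ∀ θ : I, exp (L θ) = r * exp (2 * Real.pi * Complex.I * (θ : ℝ))) : L 0 ≠ L 1 := by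
  intro h01
  have := sub_eq_sub_of_exp_eq (f := L)
    (g := fun θ : I => log r + 2 * Real.pi * Complex.I * (θ : ℝ)) hL
    (by fun_prop) (fun θ => by rw [h, exp_add, exp_log hr]) 0 1
  simp [h01] at this

/-- In the punctured plane, a circle around the puncture is not freely homotopic to a constant. -/
theorem not_homotopic_circle_const {r c : ℂ} (hr : r ≠ 0) {K : I × I → ℂ} (hK : Continuous K)
    (h0 : ∀ x, K x ≠ 0) (hloop : ∀ t, K (t, 0) = K (t, 1))
    (hcirc : ∀ θ : I, K (0, θ) = r * exp (2 * Real.pi * Complex.I * (θ : ℝ)))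
    (hconst : ∀ θ, K (1, θ) = c) : False := by
  -- the increment of a logarithm along the loop does not change during the homotopy
  obtain ⟨L, hL, hLK⟩ := exists_continuous_log hK h0
  refine not_closed_log_circle hr (L := fun θ => L (0, θ)) (by fun_prop)
    (fun θ => by rw [hLK, hcirc]) ?_
  have h1 := sub_eq_sub_of_exp_eq (f := fun θ => L (1, θ)) (g := fun _ => L (1, 0)) (by fun_prop)
    (by fun_prop) (fun θ => by simp only [hLK, hconst]) 0 1
  have h2 := sub_eq_sub_of_exp_eq (f := fun t => L (t, 0)) (g := fun t => L (t, 1)) (by fun_prop)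
    (by fun_prop) (fun θ => by simp only [hLK, hloop]) 0 1
  simp only [sub_self] at h1
  rw [← sub_eq_zero.1 h1.symm, sub_self] at h2
  exact sub_eq_zero.1 h2

/-- A loop in the left half plane has a closed logarithm. -/
theorem exists_loop_log {x : ℂ} (f : I → ℂ) (hf : Continuous f) (h0 : f 0 = x) (h1 : f 1 = x)
    (hre : ∀ t, (f t).re < 0) :
    ∃ γ : Path (log (-x) + Real.pi * Complex.I) (log (-x) + Real.pi * Complex.I),
      ∀ t, exp (γ t) = f t := by
  have hs : ∀ t, -f t ∈ slitPlane := fun t => Or.inl (by simpa using hre t)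
  refine ⟨⟨⟨fun t => log (-f t) + Real.pi * Complex.I, ?_⟩, by simp [h0], by simp [h1]⟩,
    fun t => ?_⟩
  · exact (hf.neg.clog hs).add continuous_const
  · have : -f t ≠ 0 := slitPlane_ne_zero (hs t)
    simp [exp_add, exp_log this, exp_pi_mul_I]

/-- Each of the finitely many generators of the fundamental group is carried by a compact set, so
for large `n` their images under `f - n` stay in a half plane, and the lifting criterion gives a
global logarithm. -/
theorem exists_log_sub_natCast {X : Type*} [TopologicalSpace X] [PathConnectedSpace X]
    [LocallyPathConnectedSpace X] {x : X} (hfg : Group.FG (FundamentalGroup X x)) {f : X → ℂ}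
    (hf : Continuous f) (h0 : ∀ y, ∀ n : ℕ, f y ≠ n) :
    ∃ N : ℕ, ∀ n : ℕ, N ≤ n → ∃ L : X → ℂ, Continuous L ∧ ∀ y, exp (L y) = f y - n := by
  obtain ⟨T, hT, hTfin⟩ := (Group.fg_iff).1 hfg
  have hbound : ∀ γ : FundamentalGroup X x, ∃ N : ℕ, ∃ c : Path x x,
      Path.Homotopic.Quotient.mk c = γ ∧ ∀ t, (f (c t)).re < N := by
    intro γ
    obtain ⟨c, hc⟩ := Path.Homotopic.Quotient.mk_surjective γ
    obtain ⟨C, hC⟩ := (isCompact_range (f := fun t => (f (c t)).re) (by fun_prop)).bddAbove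
    obtain ⟨N, hN⟩ := exists_nat_gt C
    exact ⟨N, c, hc, fun t => (hC ⟨t, rfl⟩).trans_lt hN⟩
  choose N c hc hcN using hbound
  obtain ⟨B, hB⟩ := (hTfin.image N).bddAbove
  obtain ⟨C, hC⟩ := exists_nat_gt (f x).re
  refine ⟨max B C, fun n hn => ?_⟩
  let F : C(X, {z : ℂ // z ≠ 0}) := ⟨fun y => ⟨f y - n, sub_ne_zero.2 (h0 y n)⟩, by fun_prop⟩
  have hx : (f x - n).re < 0 := by
    have : (C : ℝ) ≤ n := by exact_mod_cast (le_max_right _ _).trans hn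
    simp; linarith
  have hne : -(f x - n) ≠ 0 := fun h => by rw [neg_eq_zero.1 h] at hx; simp at hx
  have he : (⟨exp (log (-(f x - n)) + Real.pi * Complex.I), exp_ne_zero _⟩ : {z : ℂ // z ≠ 0}) =
      F x := by
    apply Subtype.ext
    change exp (log (-(f x - n)) + Real.pi * Complex.I) = f x - n
    rw [exp_add, exp_log hne, exp_pi_mul_I]; ring
  have hle : (FundamentalGroup.map F x).range ≤
      (FundamentalGroup.mapOfEq ⟨_, isCoveringMap_exp.continuous⟩ he).range := by
    rw [MonoidHom.range_eq_map, ← hT, MonoidHom.map_closure, Subgroup.closure_le]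
    rintro _ ⟨γ, hγ, rfl⟩
    obtain ⟨δ, hδ⟩ := exists_loop_log (x := f x - n) (fun t => f (c γ t) - n) (by fun_prop)
      (by simp) (by simp) (fun t => by
        have h1 : (N γ : ℝ) ≤ n := by
          exact_mod_cast (hB ⟨γ, hγ, rfl⟩).trans ((le_max_left _ _).trans hn)
        have := hcN γ t
        simp; linarith)
    refine ⟨FundamentalGroup.fromPath (Path.Homotopic.Quotient.mk δ), ?_⟩
    rw [FundamentalGroup.mapOfEq_apply, ← hc γ]
    refine congrArg Path.Homotopic.Quotient.mk (Path.ext (funext fun t => Subtype.ext ?_))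
    exact hδ t
  obtain ⟨L, ⟨-, hL⟩, -⟩ := isCoveringMap_exp.existsUnique_continuousMap_lifts_of_range_le he hle
  exact ⟨L, L.continuous, fun y => congrArg Subtype.val (congrFun hL y)⟩

end

/-! ### Surfaces spread over the plane -/

section

open Topology
open scoped Manifold

/-- The atlas given by a local homeomorphism `q : X → H`: its charts are the restrictions of `q` to
the open sets on which it is injective. -/
@[reducible] noncomputable def IsLocalHomeomorph.restrictionChartedSpace {X H : Type*}
    [TopologicalSpace X] [TopologicalSpace H] {q : X → H} (hq : IsLocalHomeomorph q) :
    ChartedSpace H X where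
  atlas := {e | ⇑e = q}
  chartAt x := (hq x).choose
  mem_chart_source x := (hq x).choose_spec.1
  chart_mem_atlas x := (hq x).choose_spec.2.symm

theorem mem_orientationGroupoid_of_eqOn_id {e : OpenPartialHomeomorph ℂ ℂ}
    (he : ∀ z ∈ e.source, e z = z) : e ∈ orientationGroupoid := by
  have he' : ∀ z ∈ e.target, e.symm z = z := fun z hz => by
    rw [← he _ (e.map_target hz), e.right_inv hz]
  exact mem_groupoid_of_pregroupoid.2
    ⟨fun z hz => (PreservesOrientationAt.id z).congr
      (Filter.eventually_of_mem (e.open_source.mem_nhds hz) he),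
    fun z hz => (PreservesOrientationAt.id z).congr
      (Filter.eventually_of_mem (e.open_target.mem_nhds hz) he')⟩

/-- A homeomorphism over `ℂ` is the identity when read in charts that are restrictions of the
projection. -/
theorem symm_trans_homeomorph_trans_mem_orientationGroupoid {X : Type*} [TopologicalSpace X]
    {q : X → ℂ} {h : X ≃ₜ X} (hh : ∀ x, q (h x) = q x) {e e' : OpenPartialHomeomorph X ℂ}
    (he : ⇑e = q) (he' : ⇑e' = q) :
    e.symm ≫ₕ h.toOpenPartialHomeomorph ≫ₕ e' ∈ orientationGroupoid := by
  refine mem_orientationGroupoid_of_eqOn_id fun z hz => ?_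
  have hz1 : z ∈ e.target := by
    have := hz
    simp only [OpenPartialHomeomorph.trans_source] at this
    exact this.1
  change e' (h (e.symm z)) = z
  rw [he', hh, ← he, e.right_inv hz1]

theorem IsLocalHomeomorph.hasGroupoid_orientationGroupoid {X : Type*} [TopologicalSpace X]
    {q : X → ℂ} (hq : IsLocalHomeomorph q) :
    letI := hq.restrictionChartedSpace
    HasGroupoid X orientationGroupoid := by
  let _ := hq.restrictionChartedSpace
  refine ⟨fun {e e'} he he' => mem_orientationGroupoid_of_eqOn_id fun z hz => ?_⟩
  have hz1 : z ∈ e.target := hz.1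
  change e' (e.symm z) = z
  rw [show ⇑e' = q from he', ← show ⇑e = q from he, e.right_inv hz1]

theorem IsSeparatedMap.t2Space {X Y : Type*} [TopologicalSpace X] [TopologicalSpace Y] [T2Space Y]
    {f : X → Y} (hf : Continuous f) (h : IsSeparatedMap f) : T2Space X := by
  refine ⟨fun x y hxy => ?_⟩
  by_cases hp : f x = f y
  · exact h x y hp hxy
  · exact separated_by_continuous hf hp

end

/-! ### The slit flute surface -/

section

open Topology

/-- The sign of `im z` on the part of the lines `re z = n` that is kept in the slit plane `i`. -/
def slitSign (i : Bool) : ℝ := if i then 1 else -1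

/-- The flute surface, cut along the vertical rays going down (`i = true`) or up (`i = false`) from
the punctures. -/
def fluteSlit (i : Bool) : Set FluteSurface :=
  {z | ∀ n : ℕ, z.1.re = n → 0 < slitSign i * z.1.im}

theorem isClosed_range_natCast_real : IsClosed (Set.range (Nat.cast : ℕ → ℝ)) :=
  Nat.isClosedEmbedding_coe_real.isClosed_range

theorem isOpen_fluteSlit (i : Bool) : IsOpen (fluteSlit i) := by
  have : fluteSlit i = {z : FluteSurface | z.1.re ∈ Set.range (Nat.cast : ℕ → ℝ) ∧
      slitSign i * z.1.im ≤ 0}ᶜ := by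
    ext z
    simp only [fluteSlit, Set.mem_ofPred_eq, Set.mem_compl_iff, Set.mem_range, not_and, not_le]
    exact ⟨fun h ⟨n, hn⟩ => h n hn.symm, fun h n hn => h ⟨n, hn.symm⟩⟩
  rw [this, isOpen_compl_iff]
  refine (isClosed_range_natCast_real.preimage
    (f := fun z : FluteSurface => z.1.re) (by fun_prop)).inter
    (isClosed_le
    (f := fun z : FluteSurface => slitSign i * z.1.im) (by fun_prop) continuous_const)

theorem FluteSurface.im_ne_zero {z : FluteSurface} {n : ℕ} (h : z.1.re = n) : z.1.im ≠ 0 :=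
  fun h0 => z.2 n (Complex.ext (by simpa using h) (by simpa using h0))

theorem mem_fluteSlit (z : FluteSurface) (i : Bool) (h : 0 ≤ slitSign i * z.1.im) :
    z ∈ fluteSlit i :=
  fun n hn => lt_of_le_of_ne h fun h0 => by
    rcases mul_eq_zero.1 h0.symm with h1 | h1
    · cases i <;> simp [slitSign] at h1
    · exact FluteSurface.im_ne_zero hn h1

theorem mem_fluteSlit_decide (z : FluteSurface) : z ∈ fluteSlit (decide (0 ≤ z.1.im)) := by
  apply mem_fluteSlit
  by_cases h : 0 ≤ z.1.im <;> simp [h, slitSign]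
  exact (not_le.1 h).le

theorem re_not_mem_of_mem_fluteSlit {z : FluteSurface} (h1 : z ∈ fluteSlit true)
    (h2 : z ∈ fluteSlit false) (n : ℕ) : z.1.re ≠ n := fun h => by
  have h1 := h1 n h
  have h2 := h2 n h
  simp [slitSign] at h1 h2
  linarith

theorem eventually_ceil_eq {x : ℝ} (h : ∀ n : ℕ, x ≠ n) : ∀ᶠ y in 𝓝 x, ⌈y⌉₊ = ⌈x⌉₊ := by
  rcases lt_or_ge x 0 with hx | hx
  · filter_upwards [gt_mem_nhds hx] with y hy
    rw [Nat.ceil_eq_zero.2 hy.le, Nat.ceil_eq_zero.2 hx.le]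
  · have h0 : ⌈x⌉₊ ≠ 0 := fun h0 => h 0 (by simpa using le_antisymm (Nat.ceil_eq_zero.1 h0) hx)
    obtain ⟨h1, h2⟩ := (Nat.ceil_eq_iff h0).1 rfl
    filter_upwards [lt_mem_nhds h1, gt_mem_nhds (lt_of_le_of_ne h2 (h _))] with y hy1 hy2
    exact (Nat.ceil_eq_iff h0).2 ⟨hy1, hy2.le⟩

/-- A slit plane is a half plane together with vertical rays ending in it. -/
theorem isPreconnected_fluteSlit (i : Bool) : IsPreconnected (fluteSlit i) := by
  have hind : IsInducing (Subtype.val : FluteSurface → ℂ) := IsInducing.subtypeVal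
  rw [← hind.isPreconnected_image]
  have himg : Subtype.val '' fluteSlit i =
      {z : ℂ | ∀ n : ℕ, z.re = n → 0 < slitSign i * z.im} := by
    ext z
    constructor
    · rintro ⟨w, hw, rfl⟩; exact hw
    · intro hz
      refine ⟨⟨z, fun n hn => ?_⟩, hz, rfl⟩
      simpa [hn] using hz n (by simp [hn])
  rw [himg]
  have hs : slitSign i * slitSign i = 1 := by cases i <;> simp [slitSign]
  have hH : Convex ℝ {w : ℂ | 0 < slitSign i * w.im} := by
    intro x hx y hy a b ha hb hab
    simp only [Set.mem_ofPred_eq, Complex.add_im, Complex.real_smul, Complex.mul_im,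
      Complex.ofReal_re, Complex.ofReal_im, zero_mul, add_zero] at hx hy ⊢
    have h1 : slitSign i * (a * x.im + b * y.im) =
        a * (slitSign i * x.im) + b * (slitSign i * y.im) := by ring
    rw [h1]
    rcases ha.eq_or_lt with rfl | ha
    · have : b = 1 := by linarith
      subst this; linarith
    · have := mul_pos ha hx
      have := mul_nonneg hb hy.le
      linarith
  refine isPreconnected_of_forall ((slitSign i : ℂ) * Complex.I) fun z hz => ?_
  have hR : Convex ℝ {w : ℂ | w.re = z.re ∧ slitSign i * z.im ≤ slitSign i * w.im} := by
    intro x hx y hy a b ha hb hab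
    simp only [Set.mem_ofPred_eq, Complex.add_im, Complex.real_smul, Complex.mul_im, Complex.add_re,
      Complex.mul_re, Complex.ofReal_re, Complex.ofReal_im, zero_mul, add_zero, sub_zero] at hx hy ⊢
    refine ⟨by rw [hx.1, hy.1, ← add_mul, hab, one_mul], ?_⟩
    have h1 : slitSign i * (a * x.im + b * y.im) =
        a * (slitSign i * x.im) + b * (slitSign i * y.im) := by ring
    have h2 : slitSign i * z.im = a * (slitSign i * z.im) + b * (slitSign i * z.im) := by
      rw [← add_mul, hab, one_mul]
    rw [h1, h2]
    exact add_le_add (mul_le_mul_of_nonneg_left hx.2 ha) (mul_le_mul_of_nonneg_left hy.2 hb)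
  refine ⟨{w | 0 < slitSign i * w.im} ∪ {w | w.re = z.re ∧ slitSign i * z.im ≤ slitSign i * w.im},
    ?_, Or.inl (by simp [hs]), Or.inr ⟨rfl, le_rfl⟩, ?_⟩
  · rintro w (hw | ⟨hw1, hw2⟩) n hn
    · exact hw
    · exact (hz n (hw1 ▸ hn)).trans_le hw2
  · refine IsPreconnected.union (⟨z.re, slitSign i * (|z.im| + 1)⟩ : ℂ) ?_ ?_
      hH.isPreconnected hR.isPreconnected
    · simp only [Set.mem_ofPred_eq, ← mul_assoc, hs]; positivity
    · simp only [Set.mem_ofPred_eq, ← mul_assoc, hs, true_and]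
      have : slitSign i * z.im ≤ |z.im| := by
        cases i
        · simpa [slitSign] using neg_le_abs z.im
        · simpa [slitSign] using le_abs_self z.im
      linarith

end

/-! ### The principal bundle over the flute surface -/

section

open Topology

section Cover

variable {G : Type*} [Group G]

/-- Over `z`, passing from the slit plane `true` to the slit plane `i` multiplies the sheet label by
this element: for `i = false` it is `a n` over the `n`-th strip `n - 1 < re z ≤ n` (`re z ≤ 0` for
`n = 0`, by the truncation in `⌈·⌉₊`). -/
noncomputable def sheetShift (a : ℕ → G) (i : Bool) (z : FluteSurface) : G :=
  if i then 1 else a ⌈z.1.re⌉₊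

theorem sheetShift_eq_one {a : ℕ → G} {i : Bool} {z : FluteSurface} (h : a ⌈z.1.re⌉₊ = 1) :
    sheetShift a i z = 1 := by
  cases i <;> simp [sheetShift, h]

variable [TopologicalSpace G] [DiscreteTopology G]

/-- The principal `G`-bundle over the flute surface that is trivial over both slit planes and glued
along the `n`-th strip by left multiplication by `a n`. -/
noncomputable def fluteCover (a : ℕ → G) : FiberBundleCore Bool FluteSurface G where
  baseSet := fluteSlit
  isOpen_baseSet := isOpen_fluteSlit
  indexAt z := decide (0 ≤ z.1.im)
  mem_baseSet_at := mem_fluteSlit_decide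
  coordChange i j z v := sheetShift a j z * (sheetShift a i z)⁻¹ * v
  coordChange_self i z _ v := by simp
  continuousOn_coordChange i j := by
    rintro ⟨z, v⟩ ⟨⟨hi, hj⟩, -⟩
    refine ContinuousAt.continuousWithinAt ?_
    have hloc : ∀ᶠ w in 𝓝 z, sheetShift a j w * (sheetShift a i w)⁻¹ =
        sheetShift a j z * (sheetShift a i z)⁻¹ := by
      by_cases hij : i = j
      · subst hij; simp
      · have hz : ∀ n : ℕ, z.1.re ≠ n := by
          apply re_not_mem_of_mem_fluteSlit <;> cases i <;> cases j <;> simp_all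
        have hc : ContinuousAt (fun w : FluteSurface => w.1.re) z := by fun_prop
        filter_upwards [hc.eventually (eventually_ceil_eq hz)] with w hw
        simp [sheetShift, hw]
    have : ContinuousAt (fun p : FluteSurface × G => sheetShift a j z * (sheetShift a i z)⁻¹ * p.2)
        (z, v) := by fun_prop
    refine this.congr ?_
    filter_upwards [continuousAt_fst.eventually hloc] with p hp
    rw [hp]
  coordChange_comp i j k z _ v := by group

end Cover

section CoverTopology

variable {G : Type*} [Group G] [TopologicalSpace G] [DiscreteTopology G] (a : ℕ → G)

/-- The total space of the principal `G`-bundle `fluteCover a`. -/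
abbrev FluteCover : Type _ := (fluteCover a).TotalSpace

variable {a}

/-- The coordinate of a point in the fibre, which is a copy of `G`. -/
def fibreCoord (s : FluteCover a) : G := s.2

/-- The sheet of a point: its coordinate in the trivialisation over `fluteSlit true`, continued to
the rays removed from `fluteSlit true` by left continuity. -/
noncomputable def sheet (s : FluteCover a) : G :=
  (sheetShift a (decide (0 ≤ s.1.1.im)) s.1)⁻¹ * fibreCoord s

variable (a) in
/-- The point over `z` in a given sheet. -/
noncomputable def pointInSheet (u : G) (z : FluteSurface) : FluteCover a :=
  ⟨z, sheetShift a (decide (0 ≤ z.1.im)) z * u⟩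

@[simp] theorem pointInSheet_proj (u : G) (z : FluteSurface) : (pointInSheet a u z).1 = z := rfl

@[simp] theorem sheet_pointInSheet (u : G) (z : FluteSurface) : sheet (pointInSheet a u z) = u :=
  inv_mul_cancel_left _ _

@[simp] theorem pointInSheet_sheet (s : FluteCover a) : pointInSheet a (sheet s) s.1 = s :=
  congrArg (Bundle.TotalSpace.mk s.1) (mul_inv_cancel_left _ (fibreCoord s))

theorem fluteCover_proj_surjective : Function.Surjective (fluteCover a).proj :=
  fun z => ⟨pointInSheet a 1 z, rfl⟩

/-- The deck transformation of `g`, acting on the sheets by right multiplication by `g⁻¹`. -/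
noncomputable def deckMap (g : G) (s : FluteCover a) : FluteCover a :=
  pointInSheet a (sheet s * g⁻¹) s.1

@[simp] theorem deckMap_proj (g : G) (s : FluteCover a) : (deckMap g s).1 = s.1 := rfl

@[simp] theorem sheet_deckMap (g : G) (s : FluteCover a) : sheet (deckMap g s) = sheet s * g⁻¹ :=
  sheet_pointInSheet _ _

theorem localTriv_snd (i : Bool) (s : FluteCover a) :
    ((fluteCover a).localTriv i s).2 = sheetShift a i s.1 * sheet s := by
  rw [sheet, ← mul_assoc]; rfl

theorem trivializationAt_snd (z : FluteSurface) (s : FluteCover a) :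
    (trivializationAt G (fluteCover a).Fiber z s).2 =
      sheetShift a (decide (0 ≤ z.1.im)) s.1 * sheet s :=
  localTriv_snd _ s

theorem continuous_deckMap (g : G) : Continuous (deckMap g : FluteCover a → FluteCover a) := by
  refine continuous_iff_continuousAt.2 fun s => ?_
  have hid := (FiberBundle.continuousAt_totalSpace G (E := (fluteCover a).Fiber) id).1
    (continuousAt_id (x := s))
  refine (FiberBundle.continuousAt_totalSpace G _).2 ⟨hid.1, ?_⟩
  refine (hid.2.mul_const g⁻¹).congr (Filter.Eventually.of_forall fun t => ?_)
  simp only [trivializationAt_snd, sheet_deckMap, deckMap_proj, id, mul_assoc]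

theorem deckMap_one (s : FluteCover a) : deckMap 1 s = s := by
  simp [deckMap]

theorem deckMap_mul (g h : G) (s : FluteCover a) : deckMap (g * h) s = deckMap g (deckMap h s) := by
  simp [deckMap, mul_assoc]

/-- The deck transformation of `g` as a homeomorphism. -/
noncomputable def deckHomeomorph (g : G) : FluteCover a ≃ₜ FluteCover a where
  toFun := deckMap g
  invFun := deckMap g⁻¹
  left_inv s := by rw [← deckMap_mul, inv_mul_cancel, deckMap_one]
  right_inv s := by rw [← deckMap_mul, mul_inv_cancel, deckMap_one]
  continuous_toFun := continuous_deckMap g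
  continuous_invFun := continuous_deckMap g⁻¹

theorem exists_deckMap_eq {s t : FluteCover a} (h : s.1 = t.1) : ∃ g : G, deckMap g s = t := by
  refine ⟨(sheet t)⁻¹ * sheet s, ?_⟩
  rw [deckMap, mul_inv_rev, inv_inv, mul_inv_cancel_left, h, pointInSheet_sheet]

theorem isCoveringMap_fluteCover : IsCoveringMap (fluteCover a).proj :=
  FiberBundle.isCoveringMap (F := G) (E := (fluteCover a).Fiber)

/-- The composite of the covering with the inclusion of the flute surface in the plane. -/
def planeProj (s : FluteCover a) : ℂ := s.1.1

theorem isOpen_fluteSurface : IsOpen {z : ℂ | ∀ n : ℕ, z ≠ n} := by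
  have : {z : ℂ | ∀ n : ℕ, z ≠ n} = (Set.range (Nat.cast : ℕ → ℂ))ᶜ := by
    ext z; simp [eq_comm]
  rw [this, isOpen_compl_iff]
  exact (Complex.isometry_ofReal.isClosedEmbedding.comp
    Nat.isClosedEmbedding_coe_real).isClosed_range

theorem isLocalHomeomorph_planeProj : IsLocalHomeomorph (planeProj (a := a)) :=
  (isOpen_fluteSurface.isOpenEmbedding_subtypeVal.isLocalHomeomorph).comp
    isCoveringMap_fluteCover.isLocalHomeomorph

theorem continuous_planeProj : Continuous (planeProj (a := a)) :=
  isLocalHomeomorph_planeProj.continuous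

theorem t2Space_fluteCover : T2Space (FluteCover a) :=
  isCoveringMap_fluteCover.isSeparatedMap.t2Space isCoveringMap_fluteCover.continuous

theorem secondCountableTopology_fluteCover [Countable G] :
    SecondCountableTopology (FluteCover a) := by
  have (i : Bool) : SecondCountableTopology ((fluteCover a).localTriv i).source :=
    ((fluteCover a).localTriv i).toOpenPartialHomeomorph.secondCountableTopology_source
  refine TopologicalSpace.secondCountableTopology_of_countable_cover
    (fun i => ((fluteCover a).localTriv i).open_source) (Set.eq_univ_of_forall fun s => ?_)
  exact Set.mem_iUnion.2 ⟨_, mem_fluteSlit_decide s.1⟩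

/-- A sheet over the slit plane `i`. -/
def slitSheet (a : ℕ → G) (i : Bool) (v : G) : Set (FluteCover a) :=
  {s | s.1 ∈ fluteSlit i ∧ sheetShift a i s.1 * sheet s = v}

theorem isPreconnected_slitSheet (i : Bool) (v : G) : IsPreconnected (slitSheet a i v) := by
  have h : IsPreconnected (fluteSlit i ×ˢ ({v} : Set G)) :=
    (isPreconnected_fluteSlit i).prod isPreconnected_singleton
  let e := ((fluteCover a).localTriv i).toOpenPartialHomeomorph
  have hsub : fluteSlit i ×ˢ ({v} : Set G) ⊆ e.target := fun p hp =>
    (FiberBundleCore.mem_localTriv_target _ _ p).2 hp.1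
  have h2 := h.image _ (e.continuousOn_symm.mono hsub)
  convert h2 using 1
  ext s
  constructor
  · rintro ⟨hs, hv⟩
    refine ⟨(s.1, v), ⟨hs, rfl⟩, ?_⟩
    have : e s = (s.1, v) := Prod.ext rfl ((localTriv_snd i s).trans hv)
    rw [← this]
    exact e.left_inv hs
  · rintro ⟨p, hp, rfl⟩
    have hr := e.right_inv (hsub hp)
    refine ⟨hp.1, ?_⟩
    rw [← localTriv_snd]
    exact (congrArg Prod.snd hr).trans hp.2

theorem connectedSpace_fluteCover (ha : Function.Surjective a) : ConnectedSpace (FluteCover a) := by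
  -- the two sheets labelled `u` and `v` meet over the `n`-th strip if `v = a n * u`
  have hmeet : ∀ u v : G, (slitSheet a true u ∩ slitSheet a false v).Nonempty := by
    intro u v
    obtain ⟨n, hn⟩ := ha (v * u⁻¹)
    have hre : ∀ m : ℕ, ((n : ℝ) - 1 / 2) ≠ m := fun m hm => by
      have h1 : ((2 * n : ℕ) : ℝ) = ((2 * m + 1 : ℕ) : ℝ) := by push_cast; linarith
      have h2 : 2 * n = 2 * m + 1 := by exact_mod_cast h1
      omega
    have hc : ⌈(n : ℝ) - 1 / 2⌉₊ = n := by
      rcases Nat.eq_zero_or_pos n with rfl | hpos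
      · exact Nat.ceil_eq_zero.2 (by norm_num)
      · rw [Nat.ceil_eq_iff hpos.ne']
        rw [Nat.cast_sub hpos]
        constructor <;> push_cast <;> linarith
    let z : FluteSurface :=
      ⟨⟨(n : ℝ) - 1 / 2, 0⟩, fun m hm => hre m (by simpa using congrArg Complex.re hm)⟩
    refine ⟨pointInSheet a u z, ⟨fun m hm => (hre m hm).elim, ?_⟩, fun m hm => (hre m hm).elim, ?_⟩
    · simp [sheetShift]
    · change a ⌈(n : ℝ) - 1 / 2⌉₊ * sheet (pointInSheet a u z) = v
      rw [hc, hn, sheet_pointInSheet, inv_mul_cancel_right]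
  obtain ⟨x, hx1, hx2⟩ := hmeet 1 1
  refine { toPreconnectedSpace := ⟨isPreconnected_of_forall x fun y _ => ?_⟩, toNonempty := ⟨x⟩ }
  have hy : y ∈ slitSheet a (decide (0 ≤ y.1.1.im))
      (sheetShift a (decide (0 ≤ y.1.1.im)) y.1 * sheet y) :=
    ⟨mem_fluteSlit_decide y.1, rfl⟩
  generalize decide (0 ≤ y.1.1.im) = i at hy
  generalize sheetShift a i y.1 * sheet y = v at hy
  cases i
  · obtain ⟨w, hw1, hw2⟩ := hmeet 1 v
    exact ⟨slitSheet a true 1 ∪ slitSheet a false v, Set.subset_univ _, Or.inl hx1, Or.inr hy,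
      IsPreconnected.union w hw1 hw2 (isPreconnected_slitSheet _ _) (isPreconnected_slitSheet _ _)⟩
  · obtain ⟨w, hw1, hw2⟩ := hmeet v 1
    exact ⟨slitSheet a false 1 ∪ slitSheet a true v, Set.subset_univ _, Or.inl hx2, Or.inr hy,
      IsPreconnected.union w hw2 hw1 (isPreconnected_slitSheet _ _) (isPreconnected_slitSheet _ _)⟩

/-- Where no shift occurs, the sheets are sections of the covering. -/
theorem continuousAt_pointInSheet (u : G) {z : FluteSurface}
    (h : ∀ᶠ w in 𝓝 z.1.re, a ⌈w⌉₊ = 1) : ContinuousAt (pointInSheet a u) z := by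
  have hc : ContinuousAt (fun w : FluteSurface => w.1.re) z := by fun_prop
  refine (FiberBundle.continuousAt_totalSpace G _).2 ⟨continuousAt_id, ?_⟩
  refine (continuousAt_const (y := u)).congr ?_
  filter_upwards [hc.eventually h] with w hw
  simp [trivializationAt_snd, sheetShift_eq_one hw]

/-- Where no shift occurs, the sheet is locally constant. -/
theorem eventually_sheet_eq {s : FluteCover a} (h : ∀ᶠ w in 𝓝 s.1.1.re, a ⌈w⌉₊ = 1) :
    ∀ᶠ t in 𝓝 s, sheet t = sheet s := by
  have hc : ContinuousAt (fun t : FluteCover a => t.1.1.re) s :=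
    (Complex.continuous_re.comp continuous_planeProj).continuousAt
  have hid := ((FiberBundle.continuousAt_totalSpace G (E := (fluteCover a).Fiber) id).1
    (continuousAt_id (x := s))).2
  have hid2 : ∀ᶠ t in 𝓝 s, _ = _ := hid.eventually (IsOpen.mem_nhds (isOpen_discrete {_}) rfl)
  filter_upwards [hid2, hc.eventually h] with t ht1 ht2
  simpa [trivializationAt_snd, sheetShift_eq_one ht2, sheetShift_eq_one h.self_of_nhds] using ht1

end CoverTopology

end

/-! ### Loops around punctures and winding functions -/

section

open Topology unitInterval

/-- The loop `θ ↦ n + e^{2πiθ}/4` around the `n`-th puncture. -/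
noncomputable def punctureLoop (n : ℕ) (θ : I) : ℂ :=
  n + 1 / 4 * Complex.exp (2 * Real.pi * Complex.I * (θ : ℝ))

theorem norm_punctureLoop_sub (n : ℕ) (θ : I) : ‖punctureLoop n θ - n‖ = 1 / 4 := by
  have : (2 * Real.pi * Complex.I * (θ : ℝ) : ℂ) = ((2 * Real.pi * θ : ℝ) : ℂ) * Complex.I := by
    push_cast; ring
  rw [punctureLoop, add_sub_cancel_left, norm_mul, this, Complex.norm_exp_ofReal_mul_I]
  norm_num

theorem abs_re_punctureLoop_sub_le (n : ℕ) (θ : I) : |(punctureLoop n θ).re - n| ≤ 1 / 4 := by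
  have := Complex.abs_re_le_norm (punctureLoop n θ - n)
  rwa [norm_punctureLoop_sub, Complex.sub_re, Complex.natCast_re] at this

theorem punctureLoop_ne_natCast (n : ℕ) (θ : I) (m : ℕ) : punctureLoop n θ ≠ m := by
  intro h
  have h1 := norm_punctureLoop_sub n θ
  rw [h] at h1
  have h2 : ‖(((m : ℤ) - n : ℤ) : ℂ)‖ = 1 / 4 := by push_cast; exact h1
  rw [Complex.norm_intCast] at h2
  have h3 : ((4 * |(m : ℤ) - n| : ℤ) : ℝ) = (1 : ℤ) := by
    push_cast at h2 ⊢; rw [h2]; norm_num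
  have h4 : 4 * |(m : ℤ) - n| = 1 := by exact_mod_cast h3
  omega

theorem punctureLoop_zero_eq_one (n : ℕ) : punctureLoop n 0 = punctureLoop n 1 := by
  simp [punctureLoop, Complex.exp_two_pi_mul_I]

theorem continuous_punctureLoop (n : ℕ) : Continuous (punctureLoop n) := by
  unfold punctureLoop; fun_prop

/-- A map of the plane that is the identity for `re z ≤ 1 / 4`, is constantly `1 / 2` for
`1 / 2 ≤ re z`, and vanishes only at `0`. -/
noncomputable def halfPlaneCollapse (z : ℂ) : ℂ :=
  ⟨min z.re (1 / 2), z.im * min 1 (max 0 (2 - 4 * z.re))⟩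

theorem continuous_halfPlaneCollapse : Continuous halfPlaneCollapse := by
  have h : halfPlaneCollapse = fun z => ((min z.re (1 / 2) : ℝ) : ℂ) +
      ((z.im * min 1 (max 0 (2 - 4 * z.re)) : ℝ) : ℂ) * Complex.I :=
    funext fun z => Complex.mk_eq_add_mul_I _ _
  rw [h]
  fun_prop

theorem halfPlaneCollapse_of_le {z : ℂ} (h : z.re ≤ 1 / 4) : halfPlaneCollapse z = z := by
  apply Complex.ext
  · exact min_eq_left (by linarith)
  · change z.im * min 1 (max 0 (2 - 4 * z.re)) = z.im
    rw [min_eq_left (le_max_of_le_right (by linarith)), mul_one]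

theorem halfPlaneCollapse_of_ge {z : ℂ} (h : 1 / 2 ≤ z.re) : halfPlaneCollapse z = 1 / 2 := by
  apply Complex.ext
  · change min z.re (1 / 2) = (1 / 2 : ℂ).re
    rw [min_eq_right h]; norm_num
  · change z.im * min 1 (max 0 (2 - 4 * z.re)) = (1 / 2 : ℂ).im
    rw [max_eq_left (by linarith), min_eq_right zero_le_one]; norm_num

theorem halfPlaneCollapse_ne_zero {z : ℂ} (h : z ≠ 0) : halfPlaneCollapse z ≠ 0 := by
  intro h0
  have hre : min z.re (1 / 2) = 0 := congrArg Complex.re h0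
  have hz : z.re ≤ 1 / 4 := by
    by_contra hlt
    have : 1 / 4 < min z.re (1 / 2) := lt_min (not_le.1 hlt) (by norm_num)
    linarith
  exact h ((halfPlaneCollapse_of_le hz).symm.trans h0)

section Cover

variable {G : Type*} [Group G] {a : ℕ → G}

theorem eventually_shift_eq_one {n : ℕ} (h1 : a n = 1) (h2 : a (n + 1) = 1) {x : ℝ}
    (hx1 : (n : ℝ) - 1 < x) (hx2 : x < n + 1) : ∀ᶠ y in 𝓝 x, a ⌈y⌉₊ = 1 := by
  filter_upwards [lt_mem_nhds hx1, gt_mem_nhds hx2] with y hy1 hy2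
  have hle : ⌈y⌉₊ ≤ n + 1 := Nat.ceil_le.2 (by push_cast; exact hy2.le)
  have hge : n ≤ ⌈y⌉₊ := by
    have : (n : ℝ) < (⌈y⌉₊ + 1 : ℕ) := by push_cast; linarith [Nat.le_ceil y]
    exact Nat.lt_succ_iff.1 (by exact_mod_cast this)
  rcases hge.eq_or_lt with h | h
  · rw [← h, h1]
  · rw [le_antisymm hle h, h2]

theorem eventually_shift_eq_one_of_lt_one (h0 : a 0 = 1) (h1 : a 1 = 1) {x : ℝ} (hx : x < 1) :
    ∀ᶠ y in 𝓝 x, a ⌈y⌉₊ = 1 := by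
  filter_upwards [gt_mem_nhds hx] with y hy
  have hle : ⌈y⌉₊ ≤ 1 := Nat.ceil_le.2 (by simpa using hy.le)
  interval_cases ⌈y⌉₊ <;> assumption

variable [TopologicalSpace G] [DiscreteTopology G]

variable (a) in
/-- The lift of the loop around the `n`-th puncture to a sheet. -/
noncomputable def sheetLoop (n : ℕ) (u : G) (θ : I) : FluteCover a :=
  pointInSheet a u ⟨punctureLoop n θ, punctureLoop_ne_natCast n θ⟩

/-- The loop around a puncture lifts to a loop if the strips on both sides of the puncture have
trivial shift. -/
theorem continuous_sheetLoop {n : ℕ} (h1 : a n = 1) (h2 : a (n + 1) = 1) (u : G) :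
    Continuous (sheetLoop a n u) := by
  refine continuous_iff_continuousAt.2 fun θ => ?_
  have hle := abs_le.1 (abs_re_punctureLoop_sub_le n θ)
  exact ContinuousAt.comp
    (f := fun θ : I => (⟨punctureLoop n θ, punctureLoop_ne_natCast n θ⟩ : FluteSurface))
    (continuousAt_pointInSheet u (eventually_shift_eq_one h1 h2 (by linarith) (by linarith)))
    ((continuous_punctureLoop n).subtype_mk _).continuousAt

theorem sheetLoop_zero_eq_one (n : ℕ) (u : G) : sheetLoop a n u 0 = sheetLoop a n u 1 :=
  congrArg (pointInSheet a u) (Subtype.ext (punctureLoop_zero_eq_one n))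

/-- If `π₁` were finitely generated, `z - n` would have a global logarithm on the cover for some `n`
for which the loop around the `n`-th puncture lifts to a loop. -/
theorem isInfiniteType_fluteCover [PathConnectedSpace (FluteCover a)]
    [LocallyPathConnectedSpace (FluteCover a)]
    (ha : ∀ N, ∃ n ≥ N, a n = 1 ∧ a (n + 1) = 1) : IsInfiniteType (FluteCover a) := by
  intro x hfg
  obtain ⟨N, hN⟩ := exists_log_sub_natCast hfg continuous_planeProj (fun s n => s.1.2 n)
  obtain ⟨n, hn, h1, h2⟩ := ha N
  obtain ⟨L, hL, hexp⟩ := hN n hn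
  refine not_closed_log_circle (r := 1 / 4) (by norm_num)
    (hL.comp (continuous_sheetLoop h1 h2 1)) (fun θ => ?_)
    (congrArg L (sheetLoop_zero_eq_one n 1))
  exact (hexp _).trans (add_sub_cancel_left (n : ℂ) _)

/-- A nowhere vanishing function on the cover which winds around the puncture over `0` in the sheet
`1`, but around no other puncture over `0`. It is continuous if there is no shift over the strips
`0` and `1`. -/
noncomputable def sheetOneCollapse (s : FluteCover a) : ℂ :=
  open scoped Classical in if sheet s = 1 then halfPlaneCollapse s.1.1 else 1 / 2

theorem sheetOneCollapse_ne_zero (s : FluteCover a) : sheetOneCollapse s ≠ 0 := by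
  rw [sheetOneCollapse]
  split_ifs
  · exact halfPlaneCollapse_ne_zero (by simpa using s.1.2 0)
  · norm_num

theorem continuous_sheetOneCollapse (h0 : a 0 = 1) (h1 : a 1 = 1) :
    Continuous (sheetOneCollapse (a := a)) := by
  refine continuous_iff_continuousAt.2 fun s => ?_
  rcases lt_or_ge s.1.1.re 1 with hs | hs
  · have hev := eventually_sheet_eq (eventually_shift_eq_one_of_lt_one h0 h1 hs)
    by_cases h : sheet s = 1
    · refine ((continuous_halfPlaneCollapse.comp
        continuous_planeProj).continuousAt (x := s)).congr ?_
      filter_upwards [hev] with t ht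
      simp [sheetOneCollapse, ht, h, planeProj]
    · refine (continuousAt_const (y := (1 / 2 : ℂ))).congr ?_
      filter_upwards [hev] with t ht
      simp [sheetOneCollapse, ht, h]
  · have hc : ContinuousAt (fun t : FluteCover a => t.1.1.re) s :=
      (Complex.continuous_re.comp continuous_planeProj).continuousAt
    refine (continuousAt_const (y := (1 / 2 : ℂ))).congr ?_
    filter_upwards [hc.eventually (lt_mem_nhds (show (1 / 2 : ℝ) < s.1.1.re by linarith))] with t ht
    rw [sheetOneCollapse]
    split_ifs
    · exact (halfPlaneCollapse_of_ge ht.le).symm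
    · rfl

/-- A nontrivial deck transformation is not homotopic to the identity: it moves the loop around the
puncture over `0` in the sheet `1` to a loop along which `sheetOneCollapse` is constant. -/
theorem eq_one_of_deckHomeomorph_homotopic (h0 : a 0 = 1) (h1 : a 1 = 1) {g : G}
    (h : ContinuousMap.Homotopic (ContinuousMap.id (FluteCover a))
      ((deckHomeomorph g : FluteCover a ≃ₜ FluteCover a) : C(FluteCover a, FluteCover a))) :
    g = 1 := by
  by_contra hg
  obtain ⟨H⟩ := h
  have hloop := continuous_sheetLoop (n := 0) h0 h1 1
  refine not_homotopic_circle_const (r := 1 / 4) (c := 1 / 2) (by norm_num)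
    (K := fun x => sheetOneCollapse (H (x.1, sheetLoop a 0 1 x.2)))
    ((continuous_sheetOneCollapse h0 h1).comp
      (H.continuous.comp (continuous_fst.prodMk (hloop.comp continuous_snd))))
    (fun x => sheetOneCollapse_ne_zero _) (fun t => ?_) (fun θ => ?_) (fun θ => ?_)
  · simp only [sheetLoop_zero_eq_one]
  · simp only [H.apply_zero, ContinuousMap.id_apply]
    have hle := abs_le.1 (abs_re_punctureLoop_sub_le 0 θ)
    simp only [sheetOneCollapse, sheetLoop, sheet_pointInSheet, if_true, pointInSheet_proj]
    rw [halfPlaneCollapse_of_le (by simpa using hle.2)]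
    simp [punctureLoop]
  · simp only [H.apply_one]
    change sheetOneCollapse (deckMap g (sheetLoop a 0 1 θ)) = _
    simp [sheetOneCollapse, sheetLoop, hg]

end Cover

end

/-! ### The embedding in the mapping class group -/

/-- Surjectivity of `a` makes the cover connected, `a 0 = a 1 = 1` makes `G` act faithfully up to
homotopy, and the condition `hinf` makes the surface of infinite type. -/
theorem exists_surface_of_sequence {G : Type} [Group G] [Countable G] (a : ℕ → G)
    (ha : Function.Surjective a) (h0 : a 0 = 1) (h1 : a 1 = 1)
    (hinf : ∀ N, ∃ n ≥ N, a n = 1 ∧ a (n + 1) = 1) :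
    ∃ (S : Type) (_ : TopologicalSpace S) (_ : ChartedSpace ℂ S) (_ : OrientedSurface S),
      IsInfiniteType S ∧
      ∃ (p : S → FluteSurface) (ρ : G →* homeoPlus S),
        IsRegularCovering p ∧
        (∀ h : S ≃ₜ S, h ∈ deckGroup p ↔ ∃ g : G, (ρ g : S ≃ₜ S) = h) ∧
        Function.Injective ((mappingClass S).comp ρ) := by
  let _ : TopologicalSpace G := ⊥
  have : DiscreteTopology G := ⟨rfl⟩
  let _ : ChartedSpace ℂ (FluteCover a) := isLocalHomeomorph_planeProj.restrictionChartedSpace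
  have : T2Space (FluteCover a) := t2Space_fluteCover
  have : SecondCountableTopology (FluteCover a) := secondCountableTopology_fluteCover
  have : ConnectedSpace (FluteCover a) := connectedSpace_fluteCover ha
  have : HasGroupoid (FluteCover a) orientationGroupoid :=
    isLocalHomeomorph_planeProj.hasGroupoid_orientationGroupoid
  have hS : OrientedSurface (FluteCover a) := {}
  have : LocallyPathConnectedSpace (FluteCover a) := ChartedSpace.locallyPathConnectedSpace ℂ _
  have : PathConnectedSpace (FluteCover a) := pathConnectedSpace_iff_connectedSpace.2 inferInstance
  let ρ : G →* homeoPlus (FluteCover a) :=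
    { toFun := fun g => ⟨deckHomeomorph g, fun c hc c' hc' =>
        symm_trans_homeomorph_trans_mem_orientationGroupoid (q := planeProj) (fun _ => rfl) hc hc'⟩
      map_one' := Subtype.ext (Homeomorph.ext deckMap_one)
      map_mul' := fun g h => Subtype.ext (Homeomorph.ext (deckMap_mul g h)) }
  refine ⟨FluteCover a, inferInstance, inferInstance, hS, isInfiniteType_fluteCover hinf,
    (fluteCover a).proj, ρ, ⟨isCoveringMap_fluteCover, fluteCover_proj_surjective, ?_⟩, ?_, ?_⟩
  · intro x y hxy
    obtain ⟨g, hg⟩ := exists_deckMap_eq hxy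
    exact ⟨deckHomeomorph g, fun _ => rfl, hg⟩
  · refine fun h => ⟨fun hh => ?_, ?_⟩
    · obtain ⟨x⟩ := (inferInstance : Nonempty (FluteCover a))
      obtain ⟨g, hg⟩ := exists_deckMap_eq (hh x).symm
      refine ⟨g, Homeomorph.ext (congrFun ?_)⟩
      exact isCoveringMap_fluteCover.eq_of_comp_eq (continuous_deckMap g) h.continuous
        (funext fun y => (hh y).symm) x hg
    · rintro ⟨g, rfl⟩
      exact fun _ => rfl
  · rw [injective_iff_map_eq_one]
    intro g hg
    have h := (mappingClass_eq_iff (FluteCover a) 1 (ρ g)).1 ((map_one _).trans hg.symm)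
    exact eq_one_of_deckHomeomorph_homotopic h0 h1 h

theorem exists_sequence_surjective_with_ones (G : Type*) [Group G] [Countable G] :
    ∃ a : ℕ → G, Function.Surjective a ∧ a 0 = 1 ∧ a 1 = 1 ∧
      ∀ N, ∃ n ≥ N, a n = 1 ∧ a (n + 1) = 1 := by
  obtain ⟨e, he⟩ := exists_surjective_nat G
  refine ⟨fun n => if n % 3 = 2 then e (n / 3) else 1, fun g => ?_, by simp, by simp, fun N => ?_⟩
  · obtain ⟨k, rfl⟩ := he g
    refine ⟨3 * k + 2, ?_⟩
    have h1 : (3 * k + 2) % 3 = 2 := by omega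
    have h2 : (3 * k + 2) / 3 = k := by omega
    simp only [h1, h2, if_true]
  · refine ⟨3 * N, by omega, if_neg (by omega), if_neg (by omega)⟩

/-- Every countable group `G` embeds in the mapping class group of a connected orientable surface
`S` of infinite type without boundary. Moreover `S` can be taken to be a regular cover of the flute
surface with deck group `G`, the embedding sending `g` to the class of its deck transformation. -/
theorem mainTheorem5 {G : Type*} [Group G] [Countable G] :
    ∃ (S : Type) (_ : TopologicalSpace S) (_ : ChartedSpace ℂ S) (_ : OrientedSurface S),
      IsInfiniteType S ∧
      ∃ (p : S → FluteSurface) (ρ : G →* homeoPlus S),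
        IsRegularCovering p ∧
        (∀ h : S ≃ₜ S, h ∈ deckGroup p ↔ ∃ g : G, (ρ g : S ≃ₜ S) = h) ∧
        Function.Injective ((mappingClass S).comp ρ) := by
  -- the surface has to live in `Type`, so `G` is replaced by a copy there
  let φ : G ≃* Shrink.{0} G := Shrink.mulEquiv.symm
  have : Countable (Shrink.{0} G) := φ.symm.injective.countable
  obtain ⟨a, ha, h0, h1, hinf⟩ := exists_sequence_surjective_with_ones (Shrink.{0} G)
  obtain ⟨S, _, _, hS, hI, p, ρ, hp, hdeck, hinj⟩ := exists_surface_of_sequence a ha h0 h1 hinf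
  refine ⟨S, _, _, hS, hI, p, ρ.comp φ.toMonoidHom, hp, fun h => (hdeck h).trans ?_, ?_⟩
  · exact (φ.surjective.exists (p := fun g => (ρ g : S ≃ₜ S) = h))
  · exact hinj.comp φ.injective
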